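/- Let $l\le r$ be integers, $[l..r]=[l,r]\cap\mathbb Z$, and let $\underline a=(a_l,\dots,a_r)\in\{L,R\}^{[l..r]}$, $\underline b=(b_l,\dots,b_r)\in\{+,-\}^{[l..r]}$. The rail-yard graph $RYG(l,r,\underline a,\underline b)$ is the bipartite graph with vertex set $[2l-1..2r+1]\times(\mathbb Z+\tfrac12)$ in which each even vertex $(2m,y)$, $m\in[l..r]$, is joined to the odd vertices $(2m-1,y)$ and $(2m+1,y)$ by horizontal edges, and by one diagonal edge to $(2m-1,y+1)$, $(2m-1,y-1)$, $(2m+1,y+1)$ or $(2m+1,y-1)$ according as $(a_m,b_m)$ is $(L,+)$, $(L,-)$, $(R,+)$ or $(R,-)$; there are no other edges. The vertices with abscissa $2l-1$ (resp. $2r+1$) form the left (resp. right) boundary; all other vertices are inner. A dimer covering is a set $M$ of edges, containing only finitely many diagonal edges, such that each inner vertex is incident to exactly one edge of $M$ and each boundary vertex to at most one. It is pure if moreover each left boundary vertex $(2l-1,y)$ is incident to exactly one edge of $M$ if $y>0$ and to none if $y<0$, and each right boundary vertex $(2r+1,y)$ is incident to exactly one edge of $M$ if $y<0$ and to none if $y>0$.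 Given $M$, an odd vertex carries a hole (resp. a particle) if an edge of $M$ joins it to a vertex on its right (resp. left). A left boundary vertex incident to no edge of $M$ carries a particle, and a right boundary vertex incident to no edge of $M$ carries a hole. For $m\in[l..r+1]$, the charge $c^{(M,m)}$ is the number of particles on the column $x=2m-1$ in the upper half plane $y>0$ minus the number of holes on that column in the lower half plane $y<0$. **Lemma.** Let $M$ be a pure dimer covering of $RYG(l,r,\underline a,\underline b)$. Then for every $m\in[l..r+1]$ both of these numbers are finite, and $$c^{(M,m)}=0.$$ -/

import Mathlib

namespace RailYard

/-- The two letters of an `LR` sequence. -/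
inductive Side
  | L
  | R

/-- The two signs of a sign sequence. -/
inductive Sgn
  | plus
  | minus

/-- The vertex set `[2l-1..2r+1] × (ℤ + 1/2)`: the vertex with fields `x`, `k` is the point of the
plane with abscissa `x` and ordinate `k + 1/2`. -/
@[ext]
structure Vertex (l r : ℤ) where
  x : ℤ
  k : ℤ
  le_x : 2 * l - 1 ≤ x
  x_le : x ≤ 2 * r + 1

variable {l r : ℤ}

/-- The ordinate of a vertex, a half-integer. -/
def Vertex.y (v : Vertex l r) : ℚ := (v.k : ℚ) + 1 / 2

/-- `v` is on the left boundary. -/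
def Vertex.IsLeftBoundary (v : Vertex l r) : Prop := v.x = 2 * l - 1

/-- `v` is on the right boundary. -/
def Vertex.IsRightBoundary (v : Vertex l r) : Prop := v.x = 2 * r + 1

/-- `v` is an inner vertex. -/
def Vertex.IsInner (v : Vertex l r) : Prop := ¬ v.IsLeftBoundary ∧ ¬ v.IsRightBoundary

/-- `u` is an even vertex `(2m, y)` with `m ∈ [l..r]`, and `v` is one of the two odd vertices
`(2m - 1, y)`, `(2m + 1, y)`. -/
def IsHorizontal (u v : Vertex l r) : Prop :=
  ∃ m : Set.Icc l r, u.x = 2 * (m : ℤ) ∧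
    (v.x = 2 * (m : ℤ) - 1 ∨ v.x = 2 * (m : ℤ) + 1) ∧ v.y = u.y

/-- `u` is an even vertex `(2m, y)` with `m ∈ [l..r]`, and `v` is the odd vertex to which `u` is
joined by a diagonal edge, as prescribed by `(a_m, b_m)`. -/
def IsDiagonal (a : Set.Icc l r → Side) (b : Set.Icc l r → Sgn) (u v : Vertex l r) : Prop :=
  ∃ m : Set.Icc l r, u.x = 2 * (m : ℤ) ∧
    match a m, b m with
    | Side.L, Sgn.plus => v.x = 2 * (m : ℤ) - 1 ∧ v.y = u.y + 1
    | Side.L, Sgn.minus => v.x = 2 * (m : ℤ) - 1 ∧ v.y = u.y - 1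
    | Side.R, Sgn.plus => v.x = 2 * (m : ℤ) + 1 ∧ v.y = u.y + 1
    | Side.R, Sgn.minus => v.x = 2 * (m : ℤ) + 1 ∧ v.y = u.y - 1

/-- The rail-yard graph `RYG(l, r, a, b)`: the edges are the horizontal and the diagonal ones. -/
def graph (a : Set.Icc l r → Side) (b : Set.Icc l r → Sgn) : SimpleGraph (Vertex l r) :=
  SimpleGraph.fromRel fun u v => IsHorizontal u v ∨ IsDiagonal a b u v

/-- The set of diagonal edges of the rail-yard graph. -/
def diagonalEdges (a : Set.Icc l r → Side) (b : Set.Icc l r → Sgn) : Set (Sym2 (Vertex l r)) :=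
  {e | ∃ u v, IsDiagonal a b u v ∧ e = s(u, v)}

/-- `M` has exactly one edge at `v`. -/
def ExactlyOneEdge (M : Set (Sym2 (Vertex l r))) (v : Vertex l r) : Prop :=
  ∃! e, e ∈ M ∧ v ∈ e

/-- `M` has at most one edge at `v`. -/
def AtMostOneEdge (M : Set (Sym2 (Vertex l r))) (v : Vertex l r) : Prop :=
  ∀ e ∈ M, ∀ e' ∈ M, v ∈ e → v ∈ e' → e = e'

/-- `M` has no edge at `v`. -/
def NoEdge (M : Set (Sym2 (Vertex l r))) (v : Vertex l r) : Prop :=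
  ∀ e ∈ M, v ∉ e

/-- `M` is a dimer covering of `RYG(l, r, a, b)`. -/
structure IsDimerCovering (a : Set.Icc l r → Side) (b : Set.Icc l r → Sgn)
    (M : Set (Sym2 (Vertex l r))) : Prop where
  subset_edgeSet : M ⊆ (graph a b).edgeSet
  inner : ∀ v : Vertex l r, v.IsInner → ExactlyOneEdge M v
  boundary : ∀ v : Vertex l r, v.IsLeftBoundary ∨ v.IsRightBoundary → AtMostOneEdge M v
  finite_diagonal : (M ∩ diagonalEdges a b).Finite

/-- `M` is a pure dimer covering of `RYG(l, r, a, b)`. -/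
structure IsPureDimerCovering (a : Set.Icc l r → Side) (b : Set.Icc l r → Sgn)
    (M : Set (Sym2 (Vertex l r))) : Prop extends IsDimerCovering a b M where
  left_pos : ∀ v : Vertex l r, v.IsLeftBoundary → 0 < v.y → ExactlyOneEdge M v
  left_neg : ∀ v : Vertex l r, v.IsLeftBoundary → v.y < 0 → NoEdge M v
  right_neg : ∀ v : Vertex l r, v.IsRightBoundary → v.y < 0 → ExactlyOneEdge M v
  right_pos : ∀ v : Vertex l r, v.IsRightBoundary → 0 < v.y → NoEdge M v

/-- The odd vertex `v` carries a hole: a present edge joins it to a vertex on its right. A vertex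
of the right boundary has no neighbour on its right; it carries a hole when no present edge is
incident to it. -/
def IsHole (M : Set (Sym2 (Vertex l r))) (v : Vertex l r) : Prop :=
  (∃ w : Vertex l r, s(v, w) ∈ M ∧ v.x < w.x) ∨ (v.IsRightBoundary ∧ NoEdge M v)

/-- The odd vertex `v` carries a particle: a present edge joins it to a vertex on its left. A
vertex of the left boundary has no neighbour on its left; it carries a particle when no present
edge is incident to it. -/
def IsParticle (M : Set (Sym2 (Vertex l r))) (v : Vertex l r) : Prop :=
  (∃ w : Vertex l r, s(v, w) ∈ M ∧ w.x < v.x) ∨ (v.IsLeftBoundary ∧ NoEdge M v)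

/-- The particles of the column `x = 2m - 1` in the upper half plane. -/
def upperParticles (M : Set (Sym2 (Vertex l r))) (m : ℤ) : Set (Vertex l r) :=
  {v | v.x = 2 * m - 1 ∧ 0 < v.y ∧ IsParticle M v}

/-- The holes of the column `x = 2m - 1` in the lower half plane. -/
def lowerHoles (M : Set (Sym2 (Vertex l r))) (m : ℤ) : Set (Vertex l r) :=
  {v | v.x = 2 * m - 1 ∧ v.y < 0 ∧ IsHole M v}

/-- The charge of `M` on the column `x = 2m - 1`. It is meaningful when the two sets that are
counted are finite. -/
noncomputable def charge (M : Set (Sym2 (Vertex l r))) (m : ℤ) : ℤ :=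
  ((upperParticles M m).ncard : ℤ) - ((lowerHoles M m).ncard : ℤ)

end RailYard

namespace RailYard

/-! Encode each odd column by the set of positions `k` (ordinate `k + 1/2`) of its particles; the
claim is that this set stays neutral, by induction from the left boundary, where purity makes it
exactly the negative integers. Between adjacent columns the covering is a partial injection of
positions, and only its finitely many diagonal edges move a position. Hence the holes of column `2m
- 1` are finitely moved to the vertices of column `2m` matched leftwards; taking complements, the
particles are finitely moved to the vertices matched rightwards, and these to the particles of
column `2m + 1`. Finite moves preserve neutrality (`IsNeutral.of_finitelyMoved`,
`IsDimerCovering.finitelyMoved_matched`). -/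

/-! ### Charge of sets of integers under finite displacements -/

/-- Two sets of integers that differ by moving finitely many elements. -/
def FinitelyMoved (S T : Set ℤ) : Prop :=
  (S \ T).Finite ∧ (T \ S).Finite ∧ (S \ T).ncard = (T \ S).ncard

/-- The set `S` of occupied positions has total charge zero with respect to the vacuum in which
exactly the negative positions are occupied. -/
def IsNeutral (S : Set ℤ) : Prop :=
  (S ∩ Set.Ici 0).Finite ∧ (Sᶜ ∩ Set.Iio 0).Finite ∧
    (S ∩ Set.Ici 0).ncard = (Sᶜ ∩ Set.Iio 0).ncard

theorem FinitelyMoved.symm {S T : Set ℤ} (h : FinitelyMoved S T) : FinitelyMoved T S :=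
  ⟨h.2.1, h.1, h.2.2.symm⟩

theorem FinitelyMoved.compl {S T : Set ℤ} (h : FinitelyMoved S T) : FinitelyMoved Sᶜ Tᶜ := by
  have key : ∀ A B : Set ℤ, Aᶜ \ Bᶜ = B \ A := by
    intro A B
    ext x
    simp only [Set.mem_sdiff, Set.mem_compl_iff, not_not]
    tauto
  simpa only [FinitelyMoved, key] using h.symm

/-- Replacing `S` by `T` changes the charge by `|T \ S| - |S \ T|`, wherever the moved points lie
relative to `0`. -/
theorem IsNeutral.of_finitelyMoved {S T : Set ℤ} (hS : IsNeutral S) (h : FinitelyMoved S T) :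
    IsNeutral T := by
  obtain ⟨hU, hD, hc⟩ := hS
  obtain ⟨hST, hTS, hcard⟩ := h
  have hU' : (T ∩ Set.Ici 0).Finite := (hU.union hTS).subset fun x hx => by
    by_cases hxS : x ∈ S
    · exact Or.inl ⟨hxS, hx.2⟩
    · exact Or.inr ⟨hx.1, hxS⟩
  have hD' : (Tᶜ ∩ Set.Iio 0).Finite := (hD.union hST).subset fun x hx => by
    by_cases hxS : x ∈ S
    · exact Or.inr ⟨hxS, hx.1⟩
    · exact Or.inl ⟨hxS, hx.2⟩
  refine ⟨hU', hD', ?_⟩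
  have split : ∀ (A B : Set ℤ), A.Finite → (A ∩ B).ncard + (A \ B).ncard = A.ncard :=
    fun A B hA => Set.ncard_inter_add_ncard_sdiff_eq_ncard A B hA
  have e1 := split (S ∩ Set.Ici 0) T hU
  have e2 := split (T ∩ Set.Ici 0) S hU'
  have e3 := split (Sᶜ ∩ Set.Iio 0) T hD
  have e4 := split (Tᶜ ∩ Set.Iio 0) S hD'
  have e5 := split (S \ T) (Set.Ici 0) hST
  have e6 := split (T \ S) (Set.Ici 0) hTS
  -- The parts common to `S` and `T` cancel by `r1` and `r6`; the other pieces reassemble into `S \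
  -- T` and `T \ S`, so the count is linear.
  have r1 : (S ∩ Set.Ici 0) ∩ T = (T ∩ Set.Ici 0) ∩ S := by ext; simp; tauto
  have r2 : (S ∩ Set.Ici 0) \ T = (S \ T) ∩ Set.Ici 0 := by ext; simp; tauto
  have r3 : (T ∩ Set.Ici 0) \ S = (T \ S) ∩ Set.Ici 0 := by ext; simp; tauto
  have r4 : (Sᶜ ∩ Set.Iio 0) ∩ T = (T \ S) \ Set.Ici 0 := by ext; simp; tauto
  have r5 : (Tᶜ ∩ Set.Iio 0) ∩ S = (S \ T) \ Set.Ici 0 := by ext; simp; tauto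
  have r6 : (Sᶜ ∩ Set.Iio 0) \ T = (Tᶜ ∩ Set.Iio 0) \ S := by ext; simp; tauto
  rw [r1, r2] at e1
  rw [r3] at e2
  rw [r4, r6] at e3
  rw [r5] at e4
  omega

/-- A partial injection of `ℤ` that moves finitely many points moves its domain to its range by
displacing finitely many elements. -/
theorem finitelyMoved_of_relation (G : ℤ → ℤ → Prop)
    (hr : ∀ i j j', G i j → G i j' → j = j') (hl : ∀ i i' j, G i j → G i' j → i = i')
    (hfin : {p : ℤ × ℤ | G p.1 p.2 ∧ p.1 ≠ p.2}.Finite) :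
    FinitelyMoved {i | ∃ j, G i j} {j | ∃ i, G i j} := by
  set X := {p : ℤ × ℤ | G p.1 p.2 ∧ p.1 ≠ p.2}
  have hA : (Prod.fst '' X).Finite := hfin.image _
  have hB : (Prod.snd '' X).Finite := hfin.image _
  have cA : (Prod.fst '' X).ncard = X.ncard := Set.InjOn.ncard_image <| by
    rintro ⟨i, j⟩ ⟨h, -⟩ ⟨i', j'⟩ ⟨h', -⟩ (rfl : i = i')
    exact Prod.ext rfl (hr _ _ _ h h')
  have cB : (Prod.snd '' X).ncard = X.ncard := Set.InjOn.ncard_image <| by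
    rintro ⟨i, j⟩ ⟨h, -⟩ ⟨i', j'⟩ ⟨h', -⟩ (rfl : j = j')
    exact Prod.ext (hl _ _ _ h h') rfl
  -- A fixed point lies in both domain and range and in no displaced pair, so only the finite set
  -- `X` contributes to the differences.
  have dA : {i | ∃ j, G i j} \ {j | ∃ i, G i j} = Prod.fst '' X \ Prod.snd '' X := by
    ext i
    constructor
    · rintro ⟨⟨j, hj⟩, hi⟩
      refine ⟨⟨(i, j), ⟨hj, fun (h : i = j) => hi ⟨i, ?_⟩⟩, rfl⟩, ?_⟩
      · rwa [← h] at hj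
      · rintro ⟨⟨i', j'⟩, ⟨h, -⟩, rfl⟩
        exact hi ⟨i', h⟩
    · rintro ⟨⟨⟨i', j⟩, ⟨h, hne⟩, rfl⟩, hi⟩
      refine ⟨⟨j, h⟩, ?_⟩
      rintro ⟨i, h'⟩
      by_cases e : i = i'
      · subst e
        exact hne (hr _ _ _ h' h)
      · exact hi ⟨(i, i'), ⟨h', e⟩, rfl⟩
  have dB : {j | ∃ i, G i j} \ {i | ∃ j, G i j} = Prod.snd '' X \ Prod.fst '' X := by
    ext j
    constructor
    · rintro ⟨⟨i, hi⟩, hj⟩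
      refine ⟨⟨(i, j), ⟨hi, fun (h : i = j) => hj ⟨j, ?_⟩⟩, rfl⟩, ?_⟩
      · rwa [h] at hi
      · rintro ⟨⟨i', j'⟩, ⟨h, -⟩, rfl⟩
        exact hj ⟨j', h⟩
    · rintro ⟨⟨⟨i, j'⟩, ⟨h, hne⟩, rfl⟩, hj⟩
      refine ⟨⟨i, h⟩, ?_⟩
      rintro ⟨j, h'⟩
      by_cases e : j' = j
      · subst e
        exact hne (hl _ _ _ h h')
      · exact hj ⟨(j', j), ⟨h', e⟩, rfl⟩
  refine ⟨dA ▸ hA.sdiff, dB ▸ hB.sdiff, ?_⟩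
  rw [dA, dB]
  exact (Set.ncard_eq_ncard_iff_ncard_sdiff_eq_ncard_sdiff hA hB).1 (cA.trans cB.symm)

variable {l r : ℤ} {a : Set.Icc l r → Side} {b : Set.Icc l r → Sgn} {M : Set (Sym2 (Vertex l r))}

/-! ### Edges at a vertex, holes and particles -/

theorem Vertex.y_pos_iff (v : Vertex l r) : 0 < v.y ↔ 0 ≤ v.k := by
  unfold Vertex.y
  constructor
  · intro h
    by_contra! hk
    have : (v.k : ℚ) ≤ -1 := by exact_mod_cast Int.le_sub_one_of_lt hk
    linarith
  · intro h
    have : (0 : ℚ) ≤ v.k := by exact_mod_cast h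
    linarith

theorem Vertex.y_neg_iff (v : Vertex l r) : v.y < 0 ↔ v.k < 0 := by
  unfold Vertex.y
  constructor
  · intro h
    by_contra! hk
    have : (0 : ℚ) ≤ v.k := by exact_mod_cast hk
    linarith
  · intro h
    have : (v.k : ℚ) ≤ -1 := by exact_mod_cast Int.le_sub_one_of_lt h
    linarith

theorem IsHorizontal.abscissae {u v : Vertex l r} (h : IsHorizontal u v) :
    ∃ m : ℤ, u.x = 2 * m ∧ (v.x = 2 * m - 1 ∨ v.x = 2 * m + 1) :=
  let ⟨m, h1, h2, _⟩ := h
  ⟨m, h1, h2⟩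

theorem IsHorizontal.k_eq {u v : Vertex l r} (h : IsHorizontal u v) : v.k = u.k := by
  obtain ⟨m, -, -, h⟩ := h
  simpa [Vertex.y] using h

theorem IsDiagonal.abscissae {u v : Vertex l r} (h : IsDiagonal a b u v) :
    ∃ m : ℤ, u.x = 2 * m ∧ (v.x = 2 * m - 1 ∨ v.x = 2 * m + 1) := by
  obtain ⟨m, h1, h2⟩ := h
  refine ⟨m, h1, ?_⟩
  revert h2
  cases a m <;> cases b m <;> simp +contextual

/-- An edge of the rail-yard graph joins two neighbouring columns. -/
theorem IsDimerCovering.x_of_mem (hM : IsDimerCovering a b M) {u v : Vertex l r}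
    (h : s(u, v) ∈ M) : v.x = u.x - 1 ∨ v.x = u.x + 1 := by
  have h' := hM.subset_edgeSet h
  rw [SimpleGraph.mem_edgeSet, graph, SimpleGraph.fromRel_adj] at h'
  rcases h'.2 with (h | h) | (h | h) <;> obtain ⟨m, h1, h2⟩ := h.abscissae <;> omega

/-- An edge of the covering that changes the ordinate is diagonal. -/
theorem IsDimerCovering.mem_diagonalEdges (hM : IsDimerCovering a b M) {u v : Vertex l r}
    (h : s(u, v) ∈ M) (hk : u.k ≠ v.k) : s(u, v) ∈ diagonalEdges a b := by
  have h' := hM.subset_edgeSet h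
  rw [SimpleGraph.mem_edgeSet, graph, SimpleGraph.fromRel_adj] at h'
  rcases h'.2 with (h | h) | (h | h)
  · exact absurd h.k_eq.symm hk
  · exact ⟨u, v, h, rfl⟩
  · exact absurd h.k_eq hk
  · exact ⟨v, u, h, Sym2.eq_swap⟩

theorem IsDimerCovering.atMostOneEdge (hM : IsDimerCovering a b M) (v : Vertex l r) :
    AtMostOneEdge M v := by
  by_cases h : v.IsLeftBoundary ∨ v.IsRightBoundary
  · exact hM.boundary v h
  · intro e he e' he' hv hv'
    exact (hM.inner v (not_or.1 h)).unique ⟨he, hv⟩ ⟨he', hv'⟩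

theorem IsDimerCovering.eq_of_mem (hM : IsDimerCovering a b M) {v w w' : Vertex l r}
    (h : s(v, w) ∈ M) (h' : s(v, w') ∈ M) : w = w' :=
  Sym2.congr_right.1 <| hM.atMostOneEdge v _ h _ h' (Sym2.mem_mk_left _ _) (Sym2.mem_mk_left _ _)

theorem exists_mem_of_not_noEdge {v : Vertex l r} (h : ¬ NoEdge M v) : ∃ w, s(v, w) ∈ M := by
  unfold NoEdge at h
  push Not at h
  obtain ⟨e, he, w, rfl⟩ := h
  exact ⟨w, he⟩

theorem ExactlyOneEdge.exists_mem {v : Vertex l r} (h : ExactlyOneEdge M v) :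
    ∃ w, s(v, w) ∈ M := by
  obtain ⟨e, ⟨he, w, rfl⟩, -⟩ := h
  exact ⟨w, he⟩

/-- Every vertex of a column carries either a hole or a particle. -/
theorem IsDimerCovering.isHole_iff (hM : IsDimerCovering a b M) (hlr : l ≤ r) (v : Vertex l r) :
    IsHole M v ↔ ¬ IsParticle M v := by
  constructor
  · rintro (⟨w, hw, hlt⟩ | ⟨hv, hn⟩) (⟨w', hw', hlt'⟩ | ⟨hv', hn'⟩)
    · rw [hM.eq_of_mem hw hw'] at hlt
      exact lt_asymm hlt hlt'
    · exact hn' _ hw (Sym2.mem_mk_left _ _)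
    · exact hn _ hw' (Sym2.mem_mk_left _ _)
    -- The two boundary columns are distinct because `l ≤ r`.
    · unfold Vertex.IsRightBoundary at hv
      unfold Vertex.IsLeftBoundary at hv'
      omega
  · intro h
    by_cases hn : NoEdge M v
    · refine Or.inr ⟨?_, hn⟩
      by_contra hr
      have hl : ¬ v.IsLeftBoundary := fun hl => h (Or.inr ⟨hl, hn⟩)
      obtain ⟨w, hw⟩ := (hM.inner v ⟨hl, hr⟩).exists_mem
      exact hn _ hw (Sym2.mem_mk_left _ _)
    · obtain ⟨w, hw⟩ := exists_mem_of_not_noEdge hn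
      rcases hM.x_of_mem hw with hx | hx
      · exact absurd (Or.inl ⟨w, hw, by omega⟩) h
      · exact Or.inl ⟨w, hw, by omega⟩

/-! ### Matchings between adjacent columns -/

/-- The ordinates, up to the shift by `1 / 2`, of the vertices of the column with abscissa `x` that
are matched to the column with abscissa `x'`. -/
def matched (M : Set (Sym2 (Vertex l r))) (x x' : ℤ) : Set ℤ :=
  {k | ∃ k', ∃ u v : Vertex l r, (u.x = x ∧ u.k = k) ∧ (v.x = x' ∧ v.k = k') ∧ s(u, v) ∈ M}

/-- Uniqueness of the edge at each vertex gives injectivity in both directions, and a displaced pair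
comes from a diagonal edge. -/
theorem IsDimerCovering.finitelyMoved_matched (hM : IsDimerCovering a b M) (x x' : ℤ) :
    FinitelyMoved (matched M x x') (matched M x' x) := by
  have h := finitelyMoved_of_relation
    (fun k k' => ∃ u v : Vertex l r, (u.x = x ∧ u.k = k) ∧ (v.x = x' ∧ v.k = k') ∧ s(u, v) ∈ M)
    ?_ ?_ ?_
  · suffices e : matched M x' x = {k' | ∃ k, ∃ u v : Vertex l r,
        (u.x = x ∧ u.k = k) ∧ (v.x = x' ∧ v.k = k') ∧ s(u, v) ∈ M} by
      rw [e]
      exact h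
    ext k
    constructor
    · rintro ⟨k', u, v, hu, hv, h⟩
      exact ⟨k', v, u, hv, hu, Sym2.eq_swap ▸ h⟩
    · rintro ⟨k', u, v, hu, hv, h⟩
      exact ⟨k', v, u, hv, hu, Sym2.eq_swap ▸ h⟩
  · rintro i j j' ⟨u, v, ⟨h1, h2⟩, ⟨h3, h4⟩, h⟩ ⟨u', v', ⟨h1', h2'⟩, ⟨h3', h4'⟩, h'⟩
    obtain rfl : u = u' := Vertex.ext (h1.trans h1'.symm) (h2.trans h2'.symm)
    rw [← h4, ← h4', hM.eq_of_mem h h']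
  · rintro i i' j ⟨u, v, ⟨h1, h2⟩, ⟨h3, h4⟩, h⟩ ⟨u', v', ⟨h1', h2'⟩, ⟨h3', h4'⟩, h'⟩
    obtain rfl : v = v' := Vertex.ext (h3.trans h3'.symm) (h4.trans h4'.symm)
    rw [Sym2.eq_swap] at h h'
    rw [← h2, ← h2', hM.eq_of_mem h h']
  -- An unordered edge has at most two orderings, so finiteness passes to ordered pairs.
  · have hfin : {p : Vertex l r × Vertex l r | s(p.1, p.2) ∈ M ∩ diagonalEdges a b}.Finite := by
      refine hM.finite_diagonal.preimage' (f := fun p : Vertex l r × Vertex l r => s(p.1, p.2)) ?_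
      intro e _
      induction e with | _ u v
      refine (Set.toFinite {(u, v), (v, u)}).subset ?_
      rintro ⟨u', v'⟩ h
      simpa using h
    refine (hfin.image fun p => (p.1.k, p.2.k)).subset ?_
    rintro ⟨i, j⟩ ⟨⟨u, v, ⟨-, rfl⟩, ⟨-, rfl⟩, h⟩, hne⟩
    exact ⟨(u, v), ⟨h, hM.mem_diagonalEdges h hne⟩, rfl⟩

/-- The positions of the particles of the column `x = 2m - 1`. -/
def particles (M : Set (Sym2 (Vertex l r))) (m : ℤ) : Set ℤ :=
  {k | ∃ v : Vertex l r, v.x = 2 * m - 1 ∧ v.k = k ∧ IsParticle M v}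

theorem IsDimerCovering.compl_particles (hM : IsDimerCovering a b M) (hlr : l ≤ r) {m : ℤ}
    (h1 : l ≤ m) (h2 : m ≤ r + 1) :
    (particles M m)ᶜ = {k | ∃ v : Vertex l r, v.x = 2 * m - 1 ∧ v.k = k ∧ IsHole M v} := by
  ext k
  constructor
  · intro h
    refine ⟨⟨2 * m - 1, k, by omega, by omega⟩, rfl, rfl, ?_⟩
    rw [hM.isHole_iff hlr]
    exact fun hp => h ⟨_, rfl, rfl, hp⟩
  · rintro ⟨v, h1, h2, h⟩ ⟨v', h1', h2', h'⟩
    obtain rfl : v = v' := Vertex.ext (h1.trans h1'.symm) (h2.trans h2'.symm)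
    exact (hM.isHole_iff hlr v).1 h h'

/-- As `m ≤ r` excludes the right boundary, every hole here comes from an actual edge. -/
theorem IsDimerCovering.compl_particles_eq_matched (hM : IsDimerCovering a b M) (hlr : l ≤ r)
    {m : ℤ} (h1 : l ≤ m) (h2 : m ≤ r) : (particles M m)ᶜ = matched M (2 * m - 1) (2 * m) := by
  rw [hM.compl_particles hlr h1 (by omega)]
  ext k
  constructor
  · rintro ⟨v, hx, hk, ⟨w, hw, hlt⟩ | ⟨hv, -⟩⟩
    · have := hM.x_of_mem hw
      exact ⟨w.k, v, w, ⟨hx, hk⟩, ⟨by omega, rfl⟩, hw⟩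
    · unfold Vertex.IsRightBoundary at hv
      omega
  · rintro ⟨k', v, w, ⟨hx, hk⟩, ⟨hx', -⟩, h⟩
    exact ⟨v, hx, hk, Or.inl ⟨w, h, by omega⟩⟩

theorem IsDimerCovering.particles_eq_matched (hM : IsDimerCovering a b M)
    {m : ℤ} (h1 : l ≤ m) : particles M (m + 1) = matched M (2 * m + 1) (2 * m) := by
  ext k
  constructor
  · rintro ⟨v, hx, hk, ⟨w, hw, hlt⟩ | ⟨hv, -⟩⟩
    · have := hM.x_of_mem hw
      exact ⟨w.k, v, w, ⟨by omega, hk⟩, ⟨by omega, rfl⟩, hw⟩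
    · unfold Vertex.IsLeftBoundary at hv
      omega
  · rintro ⟨k', v, w, ⟨hx, hk⟩, ⟨hx', -⟩, h⟩
    exact ⟨v, by omega, hk, Or.inl ⟨w, h, by omega⟩⟩

/-- A vertex of an even column is matched either to its left or to its right. -/
theorem IsDimerCovering.compl_matched (hM : IsDimerCovering a b M)
    {m : ℤ} (h1 : l ≤ m) (h2 : m ≤ r) :
    (matched M (2 * m) (2 * m - 1))ᶜ = matched M (2 * m) (2 * m + 1) := by
  ext k
  constructor
  · intro h
    obtain ⟨w, hw⟩ := (hM.inner ⟨2 * m, k, by omega, by omega⟩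
      ⟨by unfold Vertex.IsLeftBoundary; dsimp only; omega,
        by unfold Vertex.IsRightBoundary; dsimp only; omega⟩).exists_mem
    rcases hM.x_of_mem hw with hx | hx
    · exact absurd ⟨w.k, _, w, ⟨rfl, rfl⟩, ⟨hx, rfl⟩, hw⟩ h
    · exact ⟨w.k, _, w, ⟨rfl, rfl⟩, ⟨hx, rfl⟩, hw⟩
  · rintro ⟨i, u, v, ⟨h1, h2⟩, ⟨h3, -⟩, h⟩ ⟨j, u', v', ⟨h1', h2'⟩, ⟨h3', -⟩, h'⟩
    obtain rfl : u = u' := Vertex.ext (h1.trans h1'.symm) (h2.trans h2'.symm)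
    have := hM.eq_of_mem h h'
    subst this
    omega

/-! ### Induction over the columns -/

/-- Neutrality passes from one odd column to the next one. -/
theorem IsDimerCovering.isNeutral_particles_succ (hM : IsDimerCovering a b M) (hlr : l ≤ r)
    {m : ℤ} (h1 : l ≤ m) (h2 : m ≤ r) (h : IsNeutral (particles M m)) :
    IsNeutral (particles M (m + 1)) := by
  have hleft := (hM.finitelyMoved_matched (2 * m - 1) (2 * m)).compl
  -- `hleft` now compares the particles of column `2m - 1` with the vertices of column `2m` matched
  -- rightwards.
  rw [← hM.compl_particles_eq_matched hlr h1 h2, compl_compl, hM.compl_matched h1 h2] at hleft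
  rw [hM.particles_eq_matched h1]
  exact (h.of_finitelyMoved hleft).of_finitelyMoved (hM.finitelyMoved_matched _ _)

theorem IsPureDimerCovering.isNeutral_particles_left (hM : IsPureDimerCovering a b M)
    (hlr : l ≤ r) : IsNeutral (particles M l) := by
  have hU : particles M l ∩ Set.Ici 0 = ∅ := by
    refine Set.eq_empty_of_forall_notMem ?_
    rintro k ⟨⟨v, hx, rfl, hp⟩, hk⟩
    obtain ⟨w, hw⟩ := (hM.left_pos v hx (v.y_pos_iff.2 hk)).exists_mem
    -- No column lies left of the boundary, so the edge goes right and `v` carries a hole.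
    have hlw := w.le_x
    have hvw := hM.x_of_mem hw
    exact (hM.isHole_iff hlr v).1 (Or.inl ⟨w, hw, by omega⟩) hp
  have hD : (particles M l)ᶜ ∩ Set.Iio 0 = ∅ := by
    refine Set.eq_empty_of_forall_notMem ?_
    rintro k ⟨hp, hk⟩
    let v : Vertex l r := ⟨2 * l - 1, k, le_rfl, by omega⟩
    exact hp ⟨v, rfl, rfl, Or.inr ⟨rfl, hM.left_neg v rfl (v.y_neg_iff.2 hk)⟩⟩
  simp [IsNeutral, hU, hD]

theorem IsPureDimerCovering.isNeutral_particles (hM : IsPureDimerCovering a b M)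
    (hlr : l ≤ r) {m : ℤ} (h1 : l ≤ m) : m ≤ r + 1 → IsNeutral (particles M m) := by
  induction m, h1 using Int.leInduction with
  | base => exact fun _ => hM.isNeutral_particles_left hlr
  | succ m h1 ih =>
    exact fun h2 => hM.isNeutral_particles_succ hlr h1 (by omega) (ih (by omega))

/-! ### From positions back to vertices -/

theorem injOn_k (x : ℤ) : Set.InjOn Vertex.k {v : Vertex l r | v.x = x} :=
  fun _ hu _ hv h => Vertex.ext (Eq.trans hu (Eq.symm hv)) h

theorem image_upperParticles (M : Set (Sym2 (Vertex l r))) (m : ℤ) :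
    Vertex.k '' upperParticles M m = particles M m ∩ Set.Ici 0 := by
  ext k
  constructor
  · rintro ⟨v, ⟨hx, hy, hp⟩, rfl⟩
    exact ⟨⟨v, hx, rfl, hp⟩, v.y_pos_iff.1 hy⟩
  · rintro ⟨⟨v, hx, rfl, hp⟩, hk⟩
    exact ⟨v, ⟨hx, v.y_pos_iff.2 hk, hp⟩, rfl⟩

theorem IsDimerCovering.image_lowerHoles (hM : IsDimerCovering a b M) (hlr : l ≤ r) {m : ℤ}
    (h1 : l ≤ m) (h2 : m ≤ r + 1) :
    Vertex.k '' lowerHoles M m = (particles M m)ᶜ ∩ Set.Iio 0 := by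
  rw [hM.compl_particles hlr h1 h2]
  ext k
  constructor
  · rintro ⟨v, ⟨hx, hy, hp⟩, rfl⟩
    exact ⟨⟨v, hx, rfl, hp⟩, v.y_neg_iff.1 hy⟩
  · rintro ⟨⟨v, hx, rfl, hp⟩, hk⟩
    exact ⟨v, ⟨hx, v.y_neg_iff.2 hk, hp⟩, rfl⟩

end RailYard

theorem lemma2p1 (l r : ℤ) (hlr : l ≤ r)
    (a : Set.Icc l r → RailYard.Side) (b : Set.Icc l r → RailYard.Sgn)
    (M : Set (Sym2 (RailYard.Vertex l r))) (hM : RailYard.IsPureDimerCovering a b M)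
    (m : ℤ) (hm : m ∈ Set.Icc l (r + 1)) :
    (RailYard.upperParticles M m).Finite ∧ (RailYard.lowerHoles M m).Finite ∧
      RailYard.charge M m = 0 := by
  obtain ⟨hU, hD, hc⟩ := hM.isNeutral_particles hlr hm.1 hm.2
  have iU : Set.InjOn RailYard.Vertex.k (RailYard.upperParticles M m) :=
    (RailYard.injOn_k (2 * m - 1)).mono fun _ hv => hv.1
  have iD : Set.InjOn RailYard.Vertex.k (RailYard.lowerHoles M m) :=
    (RailYard.injOn_k (2 * m - 1)).mono fun _ hv => hv.1
  rw [← RailYard.image_upperParticles] at hU hc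
  rw [← hM.image_lowerHoles hlr hm.1 hm.2] at hD hc
  rw [iU.ncard_image, iD.ncard_image] at hc
  refine ⟨hU.of_finite_image iU, hD.of_finite_image iD, ?_⟩
  rw [RailYard.charge, hc, sub_self]
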